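/- Call a join-semilattice with least element $0$ a $\langle\vee,0\rangle$-semilattice; its homomorphisms are the maps that preserve $\vee$ and $0$, and its embeddings are the one-to-one homomorphisms. A finite $\langle\vee,0\rangle$-semilattice is distributive if $c\le a\vee b$ always implies $c=x\vee y$ for some $x\le a$ and $y\le b$, and it is Boolean if it is a Boolean lattice under its ordering. Let $\mathcal{S}$ be the category of finite $\langle\vee,0\rangle$-semilattices and $\langle\vee,0\rangle$-homomorphisms, let $\mathcal{D}_{e}$ (resp. $\mathcal{B}_{e}$) be the subcategory of $\mathcal{S}$ whose objects are the distributive (resp. Boolean) members of $\mathcal{S}$ and whose morphisms are the $\langle\vee,0\rangle$-embeddings. Theorem. There exists a functorial retraction $\langle\Phi,\varepsilon,\mu\rangle$ of $\mathcal{D}_{e}$ to $\mathcal{B}_{e}$; that is, there are a functor $\Phi\colon\mathcal{D}_{e}\to\mathcal{B}_{e}$ and, for every object $X$ of $\mathcal{D}_{e}$, $\langle\vee,0\rangle$-homomorphisms $\varepsilon_X\colon X\to\Phi(X)$ and $\mu_X\colon\Phi(X)\to X$ such that $\mu_X\circ\varepsilon_X=\mathrm{id}_X$ for every $X$, and $\Phi(f)\circ\varepsilon_X=\varepsilon_Y\circ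 f$ and $\mu_Y\circ\Phi(f)=f\circ\mu_X$ for every $\langle\vee,0\rangle$-embedding $f\colon X\to Y$ of finite distributive $\langle\vee,0\rangle$-semilattices. Furthermore, $\Phi$, $\varepsilon$ and $\mu$ can be chosen so that every $\varepsilon_X$ is a $\langle\vee,0,1\rangle$-embedding, that is, one-to-one and such that it sends the largest element of $X$ to the largest element of $\Phi(X)$. -/

import Mathlib

open CategoryTheory

universe u

/-- The category of finite join-semilattices with least element `0`, with the maps that preserve
finite joins and `0` as morphisms. -/
abbrev FinSemilat : Type (u + 1) :=
  ObjectProperty.FullSubcategory (fun S : SemilatSupCat.{u} => Finite S)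

/-- The underlying map of a morphism of finite join-semilattices with `0`. -/
def FinSemilat.fn {S T : FinSemilat.{u}} (f : S ⟶ T) : SupBotHom S.obj T.obj := f.hom

/-- A finite join-semilattice with `0` is distributive if `c ≤ a ∨ b` implies that `c = x ∨ y`
for some `x ≤ a` and `y ≤ b`. -/
def FinSemilat.IsDistributive : ObjectProperty FinSemilat.{u} := fun S =>
  ∀ a b c : S.obj, c ≤ a ⊔ b → ∃ x y : S.obj, x ≤ a ∧ y ≤ b ∧ c = x ⊔ y

/-- A finite join-semilattice with `0` is Boolean if, as an ordered set, it is (isomorphic to) a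
Boolean algebra. -/
def FinSemilat.IsBoolean : ObjectProperty FinSemilat.{u} := fun S =>
  ∃ (L : Type u) (_ : BooleanAlgebra L), Nonempty (S.obj ≃o L)

/-- The class of embeddings, that is, of one-to-one homomorphisms of join-semilattices with `0`.
(Such a map reflects the ordering, as `a ≤ b` means `a ⊔ b = b`.) -/
def FinSemilat.embeddings : MorphismProperty FinSemilat.{u} := fun _ _ f =>
  Function.Injective (FinSemilat.fn f)

instance FinSemilat.embeddings_isMultiplicative :
    FinSemilat.embeddings.{u}.IsMultiplicative where
  id_mem _ := fun _ _ h => h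
  comp_mem _ _ hf hg := fun _ _ h => hf (hg h)

/-- The subcategory of `C` whose objects are those satisfying `P` and whose morphisms are those
in `W`. -/
abbrev SubcategoryOf {C : Type*} [Category C] (P : ObjectProperty C) (W : MorphismProperty C)
    [W.IsMultiplicative] :=
  InducedWideCategory C (fun X : P.FullSubcategory => X.obj) W

/-- The inclusion functor of a subcategory. -/
abbrev SubcategoryOf.incl {C : Type*} [Category C] (P : ObjectProperty C)
    (W : MorphismProperty C) [W.IsMultiplicative] : SubcategoryOf P W ⥤ C :=
  wideInducedFunctor (fun X : P.FullSubcategory => X.obj) W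

/-- A functorial retraction `⟨Φ, ε, μ⟩` of `A` to `B`, where `A` and `B` are subcategories of `C`
with inclusion functors `I` and `J`: a functor `Φ` from `A` to `B` with morphisms
`ε X : X ⟶ Φ X` and `μ X : Φ X ⟶ X` of the category `C` such that `μ X ∘ ε X = id`,
`Φ f ∘ ε X = ε Y ∘ f` and `μ Y ∘ Φ f = f ∘ μ X` for every morphism `f : X ⟶ Y` of `A`. -/
structure FunctorialRetraction {A B C : Type*} [Category A] [Category B] [Category C]
    (I : A ⥤ C) (J : B ⥤ C) where
  Φ : A ⥤ B
  ε : ∀ X : A, I.obj X ⟶ J.obj (Φ.obj X)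
  μ : ∀ X : A, J.obj (Φ.obj X) ⟶ I.obj X
  ε_comp_μ : ∀ X : A, ε X ≫ μ X = 𝟙 (I.obj X)
  ε_comp_map : ∀ {X Y : A} (f : X ⟶ Y), ε X ≫ J.map (Φ.map f) = I.map f ≫ ε Y
  map_comp_μ : ∀ {X Y : A} (f : X ⟶ Y), J.map (Φ.map f) ≫ μ Y = μ X ≫ I.map f

/-!
For a finite distributive `X`, the semilattice `Φ X` is the powerset of the set of all triples
`(D, p, a)` where `D ⊆ X` and `p, a ∈ D` split `D`: each `x ∈ D` satisfies exactly one of `p ≤ x`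
and `x ≤ a`. When `D = X` this says that `p` is join-prime and `a` is the largest element not
above `p`; the triples with `D ≠ X` are there only to make `Φ f` one-to-one. Put

* `ε x = {(D, p, a) | ¬ x ≤ a}`,
* `μ A = ⋁ {p | (X, p, a) ∈ A}`,
* `Φ f A = {s | t → s for some t ∈ A}`, where for an embedding `f : X → Y` the relation
  `(D, p, a) → (E, q, b)` means that either `(E, q, b) = (f D, f p, f a)`, or else
  `E` is not contained in the range of `f`, `D = X` and `¬ f p ≤ b`.

`Φ f` is one-to-one because `(f D, f p, f a)` is related to `(D, p, a)` only. For a surjective `f`,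
only the first alternative ever occurs, so `Φ` preserves identities. For the triples with full
domain and a non-surjective `f` the second alternative is `q ≤ f p`, the usual relation between the
join-primes of `X` and `Y`. The identities expressing functoriality and the naturality of `ε`
and `μ` then come down to one fact on finite distributive semilattices, `exists_full_of_notMem`:
an element outside an ideal has a join-prime below it that is outside this ideal.
-/

/-! ### Split subsets and join-primes -/

/-- A subset `dom` of `X` together with two of its elements, `low` and `high`, such that each
element of `dom` is either above `low` or below `high`, and not both. No closure property
of `dom` is asked for. -/
@[ext]
structure SplitSubset (X : Type u) [LE X] where
  dom : Set X
  low : X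
  high : X
  low_mem : low ∈ dom
  high_mem : high ∈ dom
  le_high_iff : ∀ x ∈ dom, x ≤ high ↔ ¬ low ≤ x

namespace SplitSubset

instance {X : Type u} [LE X] [Finite X] : Finite (SplitSubset X) :=
  Finite.of_injective (fun t : SplitSubset X => (t.dom, t.low, t.high)) fun s t h => by
    simp only [Prod.mk.injEq] at h
    exact SplitSubset.ext h.1 h.2.1 h.2.2

theorem le_high_iff_of_dom_eq_univ {X : Type u} [LE X] {t : SplitSubset X}
    (ht : t.dom = Set.univ) (x : X) : x ≤ t.high ↔ ¬ t.low ≤ x :=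
  t.le_high_iff x (ht ▸ Set.mem_univ x)

/-- In a finite distributive semilattice `X`, an element `y` outside an ideal `I` has a join-prime
`p` below it that is outside `I`. It is given as the lower element of a splitting of `X`. -/
theorem exists_full_of_notMem {X : Type u} [SemilatticeSup X] [OrderBot X] [Finite X]
    (hX : ∀ a b c : X, c ≤ a ⊔ b → ∃ x y : X, x ≤ a ∧ y ≤ b ∧ c = x ⊔ y)
    (I : Order.Ideal X) {y : X} (hy : y ∉ I) :
    ∃ t : SplitSubset X, t.dom = Set.univ ∧ t.low ≤ y ∧ t.low ∉ I := by
  classical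
  cases nonempty_fintype X
  obtain ⟨p, hpy, hp⟩ := (Set.toFinite {p : X | p ∉ I}).exists_le_minimal hy
  have bot_lt : ¬ p ≤ ⊥ := fun h => hp.prop (I.lower h I.bot_mem)
  have prime (a b : X) (h : p ≤ a ⊔ b) : p ≤ a ∨ p ≤ b := by
    obtain ⟨x, z, hxa, hzb, hpe⟩ := hX a b p h
    by_contra! hc
    have hx : x ∈ I := by
      by_contra hxI
      exact hc.1 ((hp.le_of_le hxI (hpe ▸ le_sup_left)).trans hxa)
    have hz : z ∈ I := by
      by_contra hzI
      exact hc.2 ((hp.le_of_le hzI (hpe ▸ le_sup_right)).trans hzb)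
    exact hp.prop (hpe ▸ Order.Ideal.sup_mem hx hz)
  let a : X := (Finset.univ.filter fun x => ¬ p ≤ x).sup id
  have ha : ¬ p ≤ a := by
    refine Finset.sup_induction (p := fun x => ¬ p ≤ x) bot_lt ?_ ?_
    · exact fun x hx z hz h => (prime x z h).elim hx hz
    · exact fun x hx => (Finset.mem_filter.1 hx).2
  refine ⟨⟨Set.univ, p, a, trivial, trivial, fun x _ => ⟨fun h h' => ha (h'.trans h), fun h => ?_⟩⟩,
    rfl, hpy, hp.prop⟩
  exact Finset.le_sup (f := id) (Finset.mem_filter.2 ⟨Finset.mem_univ x, h⟩)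

end SplitSubset

/-! ### Transport along an embedding -/

section Embedding

variable {X Y Z : Type u} [SemilatticeSup X] [OrderBot X] [SemilatticeSup Y] [OrderBot Y]
  [SemilatticeSup Z] [OrderBot Z]

theorem SupBotHom.map_le_map_iff {f : SupBotHom X Y} (hf : Function.Injective f) {a b : X} :
    f a ≤ f b ↔ a ≤ b := by
  rw [← sup_eq_right, ← map_sup, hf.eq_iff, sup_eq_right]

namespace SplitSubset

/-- The image of a split subset under an embedding. -/
def map (f : SupBotHom X Y) (hf : Function.Injective f) (t : SplitSubset X) : SplitSubset Y where
  dom := f '' t.dom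
  low := f t.low
  high := f t.high
  low_mem := ⟨_, t.low_mem, rfl⟩
  high_mem := ⟨_, t.high_mem, rfl⟩
  le_high_iff := by
    rintro _ ⟨x, hx, rfl⟩
    rw [SupBotHom.map_le_map_iff hf, SupBotHom.map_le_map_iff hf, t.le_high_iff x hx]

theorem map_injective {f : SupBotHom X Y} (hf : Function.Injective f) :
    Function.Injective (map f hf) := fun _ _ h =>
  SplitSubset.ext (hf.image_injective (congrArg dom h)) (hf (congrArg low h))
    (hf (congrArg high h))

theorem map_dom_subset_range (f : SupBotHom X Y) (hf : Function.Injective f) (t : SplitSubset X) :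
    (map f hf t).dom ⊆ Set.range f :=
  Set.image_subset_range f t.dom

theorem exists_map_eq {f : SupBotHom X Y} (hf : Function.Injective f) {s : SplitSubset Y}
    (hs : s.dom ⊆ Set.range f) : ∃ t, map f hf t = s := by
  obtain ⟨p, hp⟩ := hs s.low_mem
  obtain ⟨a, ha⟩ := hs s.high_mem
  refine ⟨⟨f ⁻¹' s.dom, p, a, ?_, ?_, fun x hx => ?_⟩, SplitSubset.ext ?_ hp ha⟩
  · exact hp.substr (p := (· ∈ s.dom)) s.low_mem
  · exact ha.substr (p := (· ∈ s.dom)) s.high_mem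
  · rw [← SupBotHom.map_le_map_iff hf, ← SupBotHom.map_le_map_iff hf, hp, ha]
    exact s.le_high_iff (f x) hx
  · exact Set.image_preimage_eq_of_subset hs

theorem dom_eq_univ_of_map {f : SupBotHom X Y} (hf : Function.Injective f) {t : SplitSubset X}
    (h : (map f hf t).dom = Set.univ) : t.dom = Set.univ := by
  refine Set.eq_univ_of_forall fun x => ?_
  obtain ⟨x', hx', h'⟩ : f x ∈ (map f hf t).dom := h ▸ Set.mem_univ (f x)
  exact hf h' ▸ hx'

theorem map_dom_eq_univ {f : SupBotHom X Y} (hf : Function.Injective f)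
    (hs : Function.Surjective f) {t : SplitSubset X} (h : t.dom = Set.univ) :
    (map f hf t).dom = Set.univ := by
  change f '' t.dom = Set.univ
  rw [h, Set.image_univ_of_surjective hs]

/-- The relation between the split subsets of `X` and of `Y` which defines the action on powersets
of an embedding `f : X → Y`. -/
def Rel (f : SupBotHom X Y) (hf : Function.Injective f) (t : SplitSubset X)
    (s : SplitSubset Y) : Prop :=
  map f hf t = s ∨ (¬ s.dom ⊆ Set.range f ∧ t.dom = Set.univ ∧ ¬ f t.low ≤ s.high)

theorem rel_map_iff {f : SupBotHom X Y} (hf : Function.Injective f) {t t' : SplitSubset X} :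
    Rel f hf t (map f hf t') ↔ t = t' := by
  refine ⟨?_, fun h => Or.inl (h ▸ rfl)⟩
  rintro (h | h)
  · exact map_injective hf h
  · exact absurd (map_dom_subset_range f hf t') h.1

theorem rel_id_iff (hf : Function.Injective (SupBotHom.id X)) {t s : SplitSubset X} :
    Rel (SupBotHom.id X) hf t s ↔ t = s := by
  obtain ⟨s, rfl⟩ := exists_map_eq (s := s) hf fun x _ => ⟨x, rfl⟩
  rw [rel_map_iff hf]
  have : map (SupBotHom.id X) hf s = s := SplitSubset.ext (Set.image_id s.dom) rfl rfl
  rw [this]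

/-- If `t` splits the whole of `X`, with join-prime `p`, and `f p` is outside an ideal `I` of `Y`,
then `t` is related to a splitting of the whole of `Y` whose join-prime is below `f p` and outside
`I`. -/
theorem exists_rel_full [Finite Y]
    (hY : ∀ a b c : Y, c ≤ a ⊔ b → ∃ x y : Y, x ≤ a ∧ y ≤ b ∧ c = x ⊔ y)
    {f : SupBotHom X Y} (hf : Function.Injective f) {t : SplitSubset X} (ht : t.dom = Set.univ)
    (I : Order.Ideal Y) (hI : f t.low ∉ I) :
    ∃ u, Rel f hf t u ∧ u.dom = Set.univ ∧ u.low ≤ f t.low ∧ u.low ∉ I := by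
  by_cases hs : Function.Surjective f
  · exact ⟨map f hf t, Or.inl rfl, map_dom_eq_univ hf hs ht, le_rfl, hI⟩
  · obtain ⟨u, hu, hle, huI⟩ := exists_full_of_notMem hY I hI
    refine ⟨u, Or.inr ⟨?_, ht, ?_⟩, hu, hle, huI⟩
    · rwa [hu, Set.univ_subset_iff, Set.range_eq_univ]
    · rwa [le_high_iff_of_dom_eq_univ hu, not_not]

theorem low_le_of_rel {f : SupBotHom X Y} (hf : Function.Injective f) {t : SplitSubset X}
    {s : SplitSubset Y} (h : Rel f hf t s) (hs : s.dom = Set.univ) :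
    t.dom = Set.univ ∧ s.low ≤ f t.low := by
  rcases h with rfl | ⟨-, ht, h⟩
  · exact ⟨dom_eq_univ_of_map hf hs, le_rfl⟩
  · rw [le_high_iff_of_dom_eq_univ hs, not_not] at h
    exact ⟨ht, h⟩

/-- The preimage of a principal ideal under a homomorphism. -/
def comapIic (f : SupBotHom X Y) (b : Y) : Order.Ideal X :=
  Order.IsIdeal.toIdeal (I := {x | f x ≤ b})
    { IsLowerSet := fun _ _ h h' => (OrderHomClass.mono f h).trans h'
      Nonempty := ⟨⊥, by simp⟩
      Directed := fun x hx y hy =>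
        ⟨x ⊔ y, (map_sup f x y).trans_le (sup_le hx hy), le_sup_left, le_sup_right⟩ }

theorem mem_comapIic {f : SupBotHom X Y} {b : Y} {x : X} : x ∈ comapIic f b ↔ f x ≤ b := Iff.rfl

/-- The relations compose. If the domain of `s` is in the range of `g`, then `s` is an image `g v`,
and only `v` can be in the middle; otherwise the element in the middle is a splitting of the whole
of `Y`, which `exists_rel_full` provides. -/
theorem rel_comp_iff [Finite Y]
    (hY : ∀ a b c : Y, c ≤ a ⊔ b → ∃ x y : Y, x ≤ a ∧ y ≤ b ∧ c = x ⊔ y)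
    {f : SupBotHom X Y} (hf : Function.Injective f) {g : SupBotHom Y Z}
    (hg : Function.Injective g) (hgf : Function.Injective (g.comp f))
    {t : SplitSubset X} {s : SplitSubset Z} :
    Rel (g.comp f) hgf t s ↔ ∃ u, Rel f hf t u ∧ Rel g hg u s := by
  have map_comp : map (g.comp f) hgf t = map g hg (map f hf t) :=
    SplitSubset.ext (Set.image_comp g f t.dom) rfl rfl
  have range_comp : Set.range (g.comp f) = g '' Set.range f := Set.range_comp g f
  have range_subset : Set.range (g.comp f) ⊆ Set.range g := by
    rw [range_comp]; exact Set.image_subset_range _ _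
  have image_subset (u : SplitSubset Y) :
      (map g hg u).dom ⊆ Set.range (g.comp f) ↔ u.dom ⊆ Set.range f := by
    rw [range_comp]; exact Set.image_subset_image_iff hg
  by_cases hs : s.dom ⊆ Set.range g
  · obtain ⟨v, rfl⟩ := exists_map_eq hg hs
    simp only [rel_map_iff hg, exists_eq_right]
    rw [Rel, Rel, map_comp, (map_injective hg).eq_iff, image_subset]
    exact or_congr Iff.rfl (and_congr Iff.rfl (and_congr Iff.rfl
      (not_congr (SupBotHom.map_le_map_iff hg))))
  · have hs' : ¬ s.dom ⊆ Set.range (g.comp f) := fun h => hs (h.trans range_subset)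
    constructor
    · rintro (h | ⟨-, ht, h⟩)
      · exact absurd (h ▸ map_dom_subset_range _ hgf t) hs'
      · obtain ⟨u, hu, hu', -, huI⟩ := exists_rel_full hY hf ht (comapIic g s.high) h
        exact ⟨u, hu, Or.inr ⟨hs, hu', huI⟩⟩
    · rintro ⟨u, hu, h | ⟨-, hu', h⟩⟩
      · exact absurd (h ▸ map_dom_subset_range _ hg u) hs
      · obtain ⟨ht, hle⟩ := low_le_of_rel hf hu hu'
        exact Or.inr ⟨hs', ht, fun h' => h ((OrderHomClass.mono g hle).trans h')⟩

end SplitSubset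

/-! ### The powerset functor and the retraction -/

open SplitSubset

/-- The action of an embedding on powersets of the sets of split subsets. -/
def powersetMap (f : SupBotHom X Y) (hf : Function.Injective f) :
    SupBotHom (Set (SplitSubset X)) (Set (SplitSubset Y)) where
  toFun A := {s | ∃ t ∈ A, Rel f hf t s}
  map_sup' A B := by
    ext s
    simp only [Set.sup_eq_union, Set.mem_union, Set.mem_ofPred_eq, or_and_right, exists_or]
  map_bot' := by
    ext s
    simp

theorem mem_powersetMap {f : SupBotHom X Y} {hf : Function.Injective f} {A : Set (SplitSubset X)}
    {s : SplitSubset Y} : s ∈ powersetMap f hf A ↔ ∃ t ∈ A, Rel f hf t s := Iff.rfl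

theorem powersetMap_injective {f : SupBotHom X Y} (hf : Function.Injective f) :
    Function.Injective (powersetMap f hf) := by
  have key (A : Set (SplitSubset X)) (t : SplitSubset X) :
      map f hf t ∈ powersetMap f hf A ↔ t ∈ A := by
    simp [mem_powersetMap, rel_map_iff]
  intro A B h
  ext t
  rw [← key A, ← key B, h]

theorem powersetMap_id (hf : Function.Injective (SupBotHom.id X)) :
    powersetMap (SupBotHom.id X) hf = SupBotHom.id _ := by
  ext A s
  simp [mem_powersetMap, rel_id_iff]

theorem powersetMap_comp [Finite Y]
    (hY : ∀ a b c : Y, c ≤ a ⊔ b → ∃ x y : Y, x ≤ a ∧ y ≤ b ∧ c = x ⊔ y)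
    {f : SupBotHom X Y} (hf : Function.Injective f) {g : SupBotHom Y Z}
    (hg : Function.Injective g) (hgf : Function.Injective (g.comp f)) :
    powersetMap (g.comp f) hgf = (powersetMap g hg).comp (powersetMap f hf) := by
  ext A s
  simp only [SupBotHom.comp_apply, mem_powersetMap, rel_comp_iff hY hf hg hgf]
  exact ⟨fun ⟨t, ht, u, hu, h⟩ => ⟨u, ⟨t, ht, hu⟩, h⟩, fun ⟨u, ⟨t, ht, hu⟩, h⟩ => ⟨t, ht, u, hu, h⟩⟩

/-- The section: `x` goes to the set of those split subsets whose upper element is not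
above `x`. -/
def powersetSection (X : Type u) [SemilatticeSup X] [OrderBot X] :
    SupBotHom X (Set (SplitSubset X)) where
  toFun x := {t | ¬ x ≤ t.high}
  map_sup' x y := by
    ext t
    simp only [Set.sup_eq_union, Set.mem_union, Set.mem_ofPred_eq, sup_le_iff, not_and_or]
  map_bot' := by
    ext t
    simp

theorem mem_powersetSection {x : X} {t : SplitSubset X} :
    t ∈ powersetSection X x ↔ ¬ x ≤ t.high := Iff.rfl

theorem powersetSection_isTop {x : X} (hx : IsTop x) : IsTop (powersetSection X x) := fun _ t _ h =>
  (t.le_high_iff t.high t.high_mem).1 le_rfl ((hx t.low).trans h)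

theorem powersetMap_powersetSection [Finite X]
    (hX : ∀ a b c : X, c ≤ a ⊔ b → ∃ x y : X, x ≤ a ∧ y ≤ b ∧ c = x ⊔ y)
    {f : SupBotHom X Y} (hf : Function.Injective f) (x : X) :
    powersetMap f hf (powersetSection X x) = powersetSection Y (f x) := by
  ext s
  rw [mem_powersetMap, mem_powersetSection]
  constructor
  · rintro ⟨t, ht, rfl | ⟨-, ht', h⟩⟩
    · exact fun h => ht ((SupBotHom.map_le_map_iff hf).1 h)
    · rw [mem_powersetSection, le_high_iff_of_dom_eq_univ ht', not_not] at ht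
      exact fun h' => h ((OrderHomClass.mono f ht).trans h')
  · intro h
    by_cases hs : s.dom ⊆ Set.range f
    · obtain ⟨t, rfl⟩ := exists_map_eq hf hs
      exact ⟨t, fun h' => h (OrderHomClass.mono f h'), Or.inl rfl⟩
    · obtain ⟨t, ht, hle, htI⟩ := exists_full_of_notMem hX (comapIic f s.high) (y := x) h
      refine ⟨t, ?_, Or.inr ⟨hs, ht, htI⟩⟩
      rwa [mem_powersetSection, le_high_iff_of_dom_eq_univ ht, not_not]

open Classical in
/-- The retraction: `A` goes to the join of the lower elements of the members of `A` that are
splittings of the whole of `X`. -/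
noncomputable def powersetRetraction (X : Type u) [SemilatticeSup X] [OrderBot X] [Finite X] :
    SupBotHom (Set (SplitSubset X)) X where
  toFun A := (Set.toFinite {t ∈ A | t.dom = Set.univ}).toFinset.sup low
  map_sup' A B := by
    rw [← Finset.sup_union]
    congr 1
    ext t
    simp [or_and_right]
  map_bot' := by simp

theorem powersetRetraction_le_iff [Finite X] {A : Set (SplitSubset X)} {x : X} :
    powersetRetraction X A ≤ x ↔ ∀ t ∈ A, t.dom = Set.univ → t.low ≤ x := by
  change Finset.sup _ _ ≤ x ↔ _
  simp

theorem powersetRetraction_powersetSection [Finite X]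
    (hX : ∀ a b c : X, c ≤ a ⊔ b → ∃ x y : X, x ≤ a ∧ y ≤ b ∧ c = x ⊔ y) (x : X) :
    powersetRetraction X (powersetSection X x) = x := by
  have mem {t : SplitSubset X} (ht : t.dom = Set.univ) :
      t ∈ powersetSection X x ↔ t.low ≤ x := by
    rw [mem_powersetSection, le_high_iff_of_dom_eq_univ ht, not_not]
  apply le_antisymm
  · exact powersetRetraction_le_iff.2 fun t ht ht' => (mem ht').1 ht
  · by_contra h
    obtain ⟨t, ht, hle, htI⟩ := exists_full_of_notMem hX (Order.Ideal.principal _) h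
    exact htI (powersetRetraction_le_iff.1 le_rfl t ((mem ht).2 hle) ht)

theorem powersetRetraction_powersetMap [Finite X] [Finite Y]
    (hY : ∀ a b c : Y, c ≤ a ⊔ b → ∃ x y : Y, x ≤ a ∧ y ≤ b ∧ c = x ⊔ y)
    {f : SupBotHom X Y} (hf : Function.Injective f) (A : Set (SplitSubset X)) :
    powersetRetraction Y (powersetMap f hf A) = f (powersetRetraction X A) := by
  apply le_antisymm
  · refine powersetRetraction_le_iff.2 fun s ⟨t, htA, hts⟩ hs => ?_
    obtain ⟨ht, hle⟩ := low_le_of_rel hf hts hs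
    exact hle.trans (OrderHomClass.mono f (powersetRetraction_le_iff.1 le_rfl t htA ht))
  · -- The elements of `X` whose image is below the left-hand side form an ideal.
    let I := comapIic f (powersetRetraction Y (powersetMap f hf A))
    have hI : powersetRetraction X A ∈ I := by
      refine Finset.sup_mem (I : Set X) I.bot_mem (fun _ hx _ hy => Order.Ideal.sup_mem hx hy) _ _
        fun t ht => ?_
      rw [Set.Finite.mem_toFinset] at ht
      by_contra h
      obtain ⟨u, hu, hu', -, huI⟩ := exists_rel_full hY hf ht.2 (Order.Ideal.principal _) h
      exact huI (powersetRetraction_le_iff.1 le_rfl u ⟨t, ht.1, hu⟩ hu')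
    exact hI

end Embedding

/-! ### Bundling -/

/-- The powerset of the set of split subsets, as a finite Boolean semilattice. -/
def powersetObj (A : SubcategoryOf FinSemilat.IsDistributive.{u} FinSemilat.embeddings) :
    SubcategoryOf FinSemilat.IsBoolean.{u} FinSemilat.embeddings :=
  haveI : Finite A.obj.obj := A.obj.property
  ⟨⟨SemilatSupCat.of (Set (SplitSubset A.obj.obj)),
    inferInstanceAs (Finite (Set (SplitSubset A.obj.obj)))⟩,
    ⟨Set (SplitSubset A.obj.obj), inferInstance, ⟨OrderIso.refl _⟩⟩⟩

/-- The functorial retraction given by powersets of sets of split subsets. -/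
noncomputable def powersetFunctorialRetraction : FunctorialRetraction
    (SubcategoryOf.incl FinSemilat.IsDistributive.{u} FinSemilat.embeddings)
    (SubcategoryOf.incl FinSemilat.IsBoolean.{u} FinSemilat.embeddings) where
  Φ :=
    { obj := powersetObj
      map := fun f => ⟨ObjectProperty.homMk (powersetMap (FinSemilat.fn f.hom) f.property),
        powersetMap_injective f.property⟩
      map_id := fun A => InducedWideCategory.Hom.ext <| ObjectProperty.hom_ext _ <|
        powersetMap_id (X := A.obj.obj) Function.injective_id
      map_comp := fun {_ B _} f g => InducedWideCategory.Hom.ext <| ObjectProperty.hom_ext _ <|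
        haveI : Finite B.obj.obj := B.obj.property
        powersetMap_comp B.property f.property g.property (f ≫ g).property }
  ε A := ObjectProperty.homMk (powersetSection A.obj.obj)
  μ A :=
    haveI : Finite A.obj.obj := A.obj.property
    ObjectProperty.homMk (powersetRetraction A.obj.obj)
  ε_comp_μ A := ObjectProperty.hom_ext _ <| SupBotHom.ext fun x =>
    haveI : Finite A.obj.obj := A.obj.property
    powersetRetraction_powersetSection A.property x
  ε_comp_map {A _} f := ObjectProperty.hom_ext _ <| SupBotHom.ext fun x =>
    haveI : Finite A.obj.obj := A.obj.property
    powersetMap_powersetSection A.property f.property x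
  map_comp_μ {A B} f := ObjectProperty.hom_ext _ <| SupBotHom.ext fun x =>
    haveI : Finite A.obj.obj := A.obj.property
    haveI : Finite B.obj.obj := B.obj.property
    powersetRetraction_powersetMap B.property f.property x

theorem theoremT :
    ∃ R : FunctorialRetraction
        (SubcategoryOf.incl FinSemilat.IsDistributive.{u} FinSemilat.embeddings)
        (SubcategoryOf.incl FinSemilat.IsBoolean.{u} FinSemilat.embeddings),
      ∀ A : SubcategoryOf FinSemilat.IsDistributive.{u} FinSemilat.embeddings,
        Function.Injective (FinSemilat.fn (R.ε A)) ∧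
          ∀ a, IsTop a → IsTop (FinSemilat.fn (R.ε A) a) := by
  refine ⟨powersetFunctorialRetraction, fun A => ⟨?_, fun a ha => powersetSection_isTop ha⟩⟩
  have : Finite A.obj.obj.X := A.obj.property
  exact Function.LeftInverse.injective (g := powersetRetraction A.obj.obj.X)
    (powersetRetraction_powersetSection A.property)
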